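/- Theorem 2.1. Let $R$ be a commutative Noetherian ring, $\mathfrak a$ an ideal of $R$, $N$ a finitely generated $\mathfrak a$-torsion $R$-module (that is, every element of $N$ is annihilated by some power of $\mathfrak a$), $X$ an arbitrary $R$-module, and $\mathcal S$ a Serre subcategory of the category of $R$-modules (a class of $R$-modules that contains $0$ and is closed under taking submodules, quotients and extensions). For $r\ge 0$ let $H^r_{\mathfrak a}(-)$ denote the $r$-th right derived functor of the $\mathfrak a$-torsion functor $\Gamma_{\mathfrak a}(M)=\{x\in M : \mathfrak a^n x=0 \text{ for some } n\ge 0\}$. Let $t\ge 0$ be an integer such that $\operatorname{Ext}^{t-r}_R(N,H^r_{\mathfrak a}(X))$ belongs to $\mathcal S$ for all $r$ with $0\le r\le t$. Then $\operatorname{Ext}^t_R(N,X)$ belongs to $\mathcal S$. -/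

import Mathlib

open CategoryTheory

universe u

/-- The `I`-torsion functor `Γ_I` on `R`-modules. On objects it is
`Γ_I(M) = ⋃ₙ {x ∈ M | Iⁿ x = 0}`, which Mathlib calls `Ideal.primaryComponent M I`,
and on morphisms it is restriction. -/
noncomputable def torsionFunctor {R : Type u} [CommRing R] (I : Ideal R) :
    ModuleCat.{u} R ⥤ ModuleCat.{u} R where
  obj M := ModuleCat.of R (Ideal.primaryComponent M I)
  map f := ModuleCat.ofHom (Ideal.primaryComponent.map I f.hom)

instance torsionFunctor_additive {R : Type u} [CommRing R] (I : Ideal R) :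
    (torsionFunctor I).Additive where
  map_add := rfl

/-- The local cohomology module `Hⁿ_I(X)`: the `n`-th right derived functor of the
`I`-torsion functor `Γ_I`, evaluated at `X`. -/
noncomputable def localCohomologyModule {R : Type u} [CommRing R] (I : Ideal R) (n : ℕ)
    (X : ModuleCat.{u} R) : ModuleCat.{u} R :=
  ((torsionFunctor I).rightDerived n).obj X

/-- `M` is `I`-torsion: `Γ_I(M) = M`, i.e. each element of `M` is killed by a power of `I`. -/
def IsIdealTorsion {R : Type u} [CommRing R] (I : Ideal R) (M : Type u) [AddCommGroup M]
    [Module R M] : Prop :=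
  Ideal.primaryComponent M I = ⊤

/-! ### Torsion in injective modules -/

namespace Ideal

variable {R : Type u} [CommRing R] (I : Ideal R)

/-! Let `I` be an injective resolution of `X` and `K = Γ_𝔞(I)`. By Artin–Rees, `K` consists of
injectives (`primaryComponent_baer`); its cohomology is `H^j_𝔞(X)`, and maps from the torsion module
`N` to `I` factor through `K`. This would give a spectral sequence from `Ext^i(N, H^j_𝔞(X))` to
`Ext^{i+j}(N, X)`.

Dimension shifting replaces it. Along cycles and boundaries of `K`, `Ext.prop_cycles_succ` puts
positive `Ext` of cycles in `S`. For `t > 0`, `Ext^t(N, X)` is a quotient of `Ext^1(N, Z^{t-1}(I))`,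
which `Ext.prop_of_homology` controls by `Hom(N, H^t(K))` and `Ext^1(N, Z^{t-1}(K))`. -/

lemma exists_le_torsionBySet_pow_of_le_primaryComponent {J : Type*} {E : Type*}
    [AddCommGroup J] [Module R J] [IsNoetherian R J] [AddCommGroup E] [Module R E]
    (f : J →ₗ[R] E) (hf : ∀ x, f x ∈ primaryComponent E I) :
    ∃ m : ℕ, ∀ x, ∀ a ∈ I ^ m, a • f x = 0 := by
  let s : ℕ →o Submodule R J :=
    { toFun := fun n => (Submodule.torsionBySet R E (I ^ n : Ideal R)).comap f
      monotone' := fun m n h => Submodule.comap_mono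
        (Submodule.torsionBySet_le_torsionBySet_of_subset (Ideal.pow_le_pow_right h)) }
  obtain ⟨m, hm⟩ := monotone_stabilizes_iff_noetherian.mpr ‹IsNoetherian R J› s
  refine ⟨m, fun x a ha => ?_⟩
  obtain ⟨n, hn⟩ := (primaryComponent_mem (M := E) (I := I) _).mp (hf x)
  have hx : x ∈ s m := by
    rw [hm (max m n) (le_max_left _ _)]
    exact s.monotone (le_max_right m n) hn
  exact (Submodule.mem_torsionBySet_iff _ _).mp hx ⟨a, ha⟩

/-- Over a Noetherian ring the torsion submodule of an injective module is injective. -/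
theorem primaryComponent_baer [IsNoetherianRing R] {E : Type*} [AddCommGroup E] [Module R E]
    (hE : Module.Baer R E) : Module.Baer R (primaryComponent E I) := by
  intro J g
  let f : J →ₗ[R] E := (primaryComponent E I).subtype ∘ₗ g
  obtain ⟨m, hm⟩ := exists_le_torsionBySet_pow_of_le_primaryComponent I f fun x => (g x).2
  -- Artin–Rees gives `I^(k+m) ∩ J ⊆ I^m J`, which `f` kills. So `f` descends to a submodule of `R ⧸
  -- I^n`, and any extension to `R ⧸ I^n` has torsion values.
  obtain ⟨k, hk⟩ := Ideal.exists_pow_inf_eq_pow_smul I J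
  let n := k + m
  let p : Submodule R J := Submodule.comap J.subtype (I ^ n)
  have hpf : p ≤ LinearMap.ker f := by
    intro x hx
    have hx' : (x : R) ∈ I ^ m • (I ^ k • (⊤ : Ideal R) ⊓ J) := by
      have h := hk n (Nat.le_add_right k m)
      rw [show n - k = m from Nat.add_sub_cancel_left k m] at h
      rw [← h]
      refine ⟨?_, x.2⟩
      rw [smul_eq_mul, Ideal.mul_top]
      exact hx
    have key : ∀ y ∈ I ^ m • (I ^ k • (⊤ : Ideal R) ⊓ J), ∃ hy : y ∈ J, f ⟨y, hy⟩ = 0 := by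
      intro y hy
      refine Submodule.smul_induction_on hy ?_ ?_
      · intro a ha b hb
        exact ⟨J.smul_mem a hb.2, (map_smul f a ⟨b, hb.2⟩).trans (hm _ a ha)⟩
      · rintro y z ⟨hy, hfy⟩ ⟨hz, hfz⟩
        refine ⟨J.add_mem hy hz, (map_add f ⟨y, hy⟩ ⟨z, hz⟩).trans ?_⟩
        rw [hfy, hfz, add_zero]
    exact (key _ hx').2
  have hpi : p = LinearMap.ker ((Submodule.mkQ (I ^ n)) ∘ₗ J.subtype) := by
    rw [LinearMap.ker_comp, Submodule.ker_mkQ]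
  let i : (J ⧸ p) →ₗ[R] R ⧸ (I ^ n) :=
    p.liftQ ((Submodule.mkQ (I ^ n)) ∘ₗ J.subtype) hpi.le
  have hi : Function.Injective i := by
    rw [← LinearMap.ker_eq_bot]
    exact Submodule.ker_liftQ_eq_bot _ _ _ hpi.ge
  obtain ⟨h, hh⟩ := hE.extension_property i hi (p.liftQ f hpf)
  have hmem : ∀ r : R, h (Submodule.Quotient.mk r) ∈ primaryComponent E I := by
    intro r
    refine (primaryComponent_mem (M := E) (I := I) _).mpr ⟨n, (Submodule.mem_torsionBySet_iff _ _).mpr ?_⟩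
    rintro ⟨a, ha⟩
    change a • h _ = 0
    rw [← map_smul, ← Submodule.Quotient.mk_smul, (Submodule.Quotient.mk_eq_zero _).mpr,
      map_zero]
    exact Ideal.mul_mem_right r _ ha
  refine ⟨(h ∘ₗ Submodule.mkQ (I ^ n)).codRestrict _ hmem, fun x hx => Subtype.ext ?_⟩
  exact LinearMap.congr_fun hh (Submodule.Quotient.mk ⟨x, hx⟩)

end Ideal

/-! ### Serre classes -/

namespace CategoryTheory.ObjectProperty

variable {R : Type u} [CommRing R] {S : ObjectProperty (ModuleCat.{u} R)} [S.IsSerreClass]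

lemma of_surjective {A B : Type u} [AddCommGroup A]
    [Module R A] [AddCommGroup B] [Module R B] (f : A →ₗ[R] B) (hf : Function.Surjective f)
    (hA : S (ModuleCat.of R A)) : S (ModuleCat.of R B) :=
  haveI := (ModuleCat.epi_iff_surjective (ModuleCat.ofHom f)).mpr hf
  S.prop_of_epi (ModuleCat.ofHom f) hA

lemma of_injective {A B : Type u} [AddCommGroup A]
    [Module R A] [AddCommGroup B] [Module R B] (f : A →ₗ[R] B) (hf : Function.Injective f)
    (hB : S (ModuleCat.of R B)) : S (ModuleCat.of R A) :=
  haveI := (ModuleCat.mono_iff_injective (ModuleCat.ofHom f)).mpr hf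
  S.prop_of_mono (ModuleCat.ofHom f) hB

lemma of_exact {A B C : Type u} [AddCommGroup A]
    [Module R A] [AddCommGroup B] [Module R B] [AddCommGroup C] [Module R C]
    (f : A →ₗ[R] B) (g : B →ₗ[R] C) (h : Function.Exact f g)
    (hA : S (ModuleCat.of R A)) (hC : S (ModuleCat.of R C)) : S (ModuleCat.of R B) := by
  let T : ShortComplex (ModuleCat.{u} R) := ShortComplex.mk (ModuleCat.ofHom f) (ModuleCat.ofHom g)
    (by ext x; exact h.apply_apply_eq_zero x)
  refine S.prop_X₂_of_exact (S := T) ?_ hA hC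
  rw [ShortComplex.moduleCat_exact_iff]
  exact fun x hx => (h x).mp hx

/-- If `a : A → E` is surjective and carries the kernel of `q : A → H` into the range of
`p : P → E`, then `E` is an extension of a subquotient of `H` by a quotient of `P`. -/
lemma of_surjective_of_ker_le_range {A E H P : Type u}
    [AddCommGroup A] [Module R A] [AddCommGroup E] [Module R E] [AddCommGroup H] [Module R H]
    [AddCommGroup P] [Module R P] (a : A →ₗ[R] E) (ha : Function.Surjective a)
    (q : A →ₗ[R] H) (p : P →ₗ[R] E) (h : ∀ x, q x = 0 → a x ∈ LinearMap.range p)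
    (hH : S (ModuleCat.of R H)) (hP : S (ModuleCat.of R P)) : S (ModuleCat.of R E) := by
  have hQ : S (ModuleCat.of R (A ⧸ LinearMap.ker q)) :=
    of_injective ((LinearMap.ker q).liftQ q le_rfl)
      (LinearMap.ker_eq_bot.mp (Submodule.ker_liftQ_eq_bot _ _ _ le_rfl)) hH
  let b : (A ⧸ LinearMap.ker q) →ₗ[R] E ⧸ LinearMap.range p :=
    (LinearMap.ker q).liftQ ((LinearMap.range p).mkQ ∘ₗ a) fun x hx => by
      simpa using h x hx
  have hb : Function.Surjective b := by
    intro y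
    obtain ⟨e, rfl⟩ := Submodule.mkQ_surjective _ y
    obtain ⟨x, rfl⟩ := ha e
    exact ⟨Submodule.Quotient.mk x, rfl⟩
  refine of_exact p (LinearMap.range p).mkQ ?_ hP
    (of_surjective b hb hQ)
  rw [LinearMap.exact_iff, Submodule.ker_mkQ]

end CategoryTheory.ObjectProperty

/-! ### Dimension shifting -/

namespace CategoryTheory.Abelian.Ext

variable {R : Type u} [CommRing R] {S : ObjectProperty (ModuleCat.{u} R)} [S.IsSerreClass]

variable (N : ModuleCat.{u} R) {T : ShortComplex (ModuleCat.{u} R)} (hT : T.ShortExact)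

include hT in
lemma prop_X₂_of_shortExact {n : ℕ} (h₁ : S (ModuleCat.of R (Ext N T.X₁ n)))
    (h₃ : S (ModuleCat.of R (Ext N T.X₃ n))) : S (ModuleCat.of R (Ext N T.X₂ n)) := by
  refine ObjectProperty.of_exact (postcompOfLinear (mk₀ T.f) R N (add_zero n))
    (postcompOfLinear (mk₀ T.g) R N (add_zero n)) (fun x => ⟨fun hx => ?_, ?_⟩) h₁ h₃
  · exact covariant_sequence_exact₂ N hT x hx
  · rintro ⟨y, rfl⟩
    simp [-mk₀_comp_mk₀, T.ext_mk₀_f_comp_ext_mk₀_g]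

lemma exists_comp_extClass [Injective T.X₂] {n : ℕ} (x : Ext N T.X₁ (n + 1)) :
    ∃ y : Ext N T.X₃ n, y.comp hT.extClass rfl = x :=
  covariant_sequence_exact₁ N hT x (eq_zero_of_injective _) rfl

include hT in
lemma prop_X₁_succ [Injective T.X₂] {n : ℕ} (h : S (ModuleCat.of R (Ext N T.X₃ n))) :
    S (ModuleCat.of R (Ext N T.X₁ (n + 1))) :=
  ObjectProperty.of_surjective (postcompOfLinear hT.extClass R N rfl)
    (exists_comp_extClass N hT) h

include hT in
lemma prop_X₃_of_succ [Injective T.X₂] {n : ℕ}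
    (h : S (ModuleCat.of R (Ext N T.X₁ (n + 2)))) : S (ModuleCat.of R (Ext N T.X₃ (n + 1))) := by
  refine ObjectProperty.of_injective (postcompOfLinear hT.extClass R N (b := n + 2) rfl) ?_ h
  rw [injective_iff_map_eq_zero]
  intro x hx
  obtain ⟨y, rfl⟩ := covariant_sequence_exact₃ N hT x (n₁ := n + 2) rfl hx
  rw [eq_zero_of_injective y, zero_comp]

lemma prop_of_iso {A B : ModuleCat.{u} R} (e : A ≅ B) {n : ℕ}
    (h : S (ModuleCat.of R (Ext N A n))) : S (ModuleCat.of R (Ext N B n)) := by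
  refine ObjectProperty.of_surjective (postcompOfLinear (mk₀ e.hom) R N (add_zero n)) ?_ h
  intro x
  exact ⟨x.comp (mk₀ e.inv) (add_zero n), by simp⟩

end CategoryTheory.Abelian.Ext

/-! ### Cycles and boundaries -/

namespace CochainComplex

open HomologicalComplex Limits

variable {C : Type*} [Category* C] [Abelian C] (K : CochainComplex C ℕ) (n : ℕ)

/-- The sequence `Zⁿ ⟶ Kⁿ ⟶ Bⁿ⁺¹`. -/
@[simps]
noncomputable def cyclesBoundaries : ShortComplex C where
  X₁ := K.cycles n
  X₂ := K.X n
  X₃ := image (K.toCycles n (n + 1))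
  f := K.iCycles n
  g := factorThruImage (K.toCycles n (n + 1))
  zero := by
    rw [← cancel_mono (image.ι _), ← cancel_mono (K.iCycles _)]
    simp

lemma cyclesBoundaries_shortExact : (K.cyclesBoundaries n).ShortExact where
  exact := ShortComplex.exact_of_f_is_kernel _
    (isKernelOfComp (image.ι (K.toCycles n (n + 1)) ≫ K.iCycles (n + 1)) (K.d n (n + 1))
      (K.cyclesIsKernel n (n + 1) (by simp)) (K.cyclesBoundaries n).zero (by simp))
  mono_f := inferInstanceAs (Mono (K.iCycles n))
  epi_g := inferInstanceAs (Epi (factorThruImage (K.toCycles n (n + 1))))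

/-- The sequence `Bⁿ⁺¹ ⟶ Zⁿ⁺¹ ⟶ Hⁿ⁺¹`. -/
@[simps]
noncomputable def boundariesHomology : ShortComplex C where
  X₁ := image (K.toCycles n (n + 1))
  X₂ := K.cycles (n + 1)
  X₃ := K.homology (n + 1)
  f := image.ι (K.toCycles n (n + 1))
  g := K.homologyπ (n + 1)
  zero := by
    rw [← cancel_epi (factorThruImage (K.toCycles n (n + 1)))]
    simp

lemma boundariesHomology_shortExact : (K.boundariesHomology n).ShortExact where
  exact := ShortComplex.exact_of_g_is_cokernel _
    (isCokernelOfComp (factorThruImage (K.toCycles n (n + 1))) (K.toCycles n (n + 1))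
      (K.homologyIsCokernel n (n + 1) (by simp)) (K.boundariesHomology n).zero (by simp))
  mono_f := inferInstanceAs (Mono (image.ι (K.toCycles n (n + 1))))
  epi_g := inferInstanceAs (Epi (K.homologyπ (n + 1)))

variable {K n}

lemma epi_toCycles (h : K.ExactAt (n + 1)) : Epi (K.toCycles n (n + 1)) := by
  have : Epi (image.ι (K.toCycles n (n + 1))) :=
    (K.boundariesHomology_shortExact n).exact.epi_f (h.isZero_homology.eq_of_tgt _ _)
  rw [← image.fac (K.toCycles n (n + 1))]
  infer_instance

variable (K n) in
/-- The sequence `Zⁿ ⟶ Kⁿ ⟶ Zⁿ⁺¹`. -/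
@[simps]
noncomputable def cyclesCycles : ShortComplex C where
  X₁ := K.cycles n
  X₂ := K.X n
  X₃ := K.cycles (n + 1)
  f := K.iCycles n
  g := K.toCycles n (n + 1)
  zero := by
    rw [← cancel_mono (K.iCycles _)]
    simp

lemma cyclesCycles_shortExact (h : K.ExactAt (n + 1)) : (K.cyclesCycles n).ShortExact where
  exact := ShortComplex.exact_of_f_is_kernel _
    (isKernelOfComp (K.iCycles (n + 1)) (K.d n (n + 1))
      (K.cyclesIsKernel n (n + 1) (by simp)) (K.cyclesCycles n).zero (by simp))
  mono_f := inferInstanceAs (Mono (K.iCycles n))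
  epi_g := epi_toCycles h

/-- The map from `Zⁿ ⟶ Kⁿ ⟶ Bⁿ⁺¹` to `Zⁿ ⟶ Lⁿ ⟶ Zⁿ⁺¹` induced by a map of complexes
`K ⟶ L`. -/
@[simps]
noncomputable def cyclesBoundariesToCyclesCycles {L : CochainComplex C ℕ} (φ : K ⟶ L) (n : ℕ) :
    K.cyclesBoundaries n ⟶ L.cyclesCycles n where
  τ₁ := cyclesMap φ n
  τ₂ := φ.f n
  τ₃ := image.ι _ ≫ cyclesMap φ (n + 1)
  comm₁₂ := cyclesMap_i φ n
  comm₂₃ := by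
    change φ.f n ≫ L.toCycles n (n + 1) =
      factorThruImage (K.toCycles n (n + 1)) ≫ image.ι _ ≫ cyclesMap φ (n + 1)
    simp [← cancel_mono (L.iCycles _)]

end CochainComplex

/-! ### Replacing the spectral sequence -/

namespace CategoryTheory.Abelian

open HomologicalComplex CochainComplex

variable {R : Type u} [CommRing R] {S : ObjectProperty (ModuleCat.{u} R)} [S.IsSerreClass]
  (N : ModuleCat.{u} R)

/-- `Z^{r+1}` is an extension of `H^{r+1}` by `B^{r+1}`, and `Ext^{k+1}(N, B^{r+1})` embeds in
`Ext^{k+2}(N, Z^r)` because `K^r` is injective; this needs degree at least one. -/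
lemma Ext.prop_cycles_succ (K : CochainComplex (ModuleCat.{u} R) ℕ) [∀ n, Injective (K.X n)]
    (r k : ℕ) (h : ∀ i j, i + j = r + (k + 1) → j ≤ r →
      S (ModuleCat.of R (Ext N (K.homology j) i))) :
    S (ModuleCat.of R (Ext N (K.cycles r) (k + 1))) := by
  induction r generalizing k with
  | zero => exact Ext.prop_of_iso N K.isoHomologyπ₀.symm (h (k + 1) 0 (by lia) le_rfl)
  | succ r ih =>
    refine Ext.prop_X₂_of_shortExact N (K.boundariesHomology_shortExact r) ?_
      (h (k + 1) (r + 1) (by lia) le_rfl)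
    have : Injective (K.cyclesBoundaries r).X₂ := inferInstanceAs (Injective (K.X r))
    exact Ext.prop_X₃_of_succ N (K.cyclesBoundaries_shortExact r)
      (ih (k + 1) fun i j hij hj => h i j (by lia) (by lia))

variable {N} in
-- Connecting maps send `Ext^k(N, Z^{r+1})` onto `Ext^{k+1}(N, Z^r)`, down to `Z^0 ≅ X`.
lemma Ext.prop_of_injectiveResolution {X : ModuleCat.{u} R} (I : InjectiveResolution X)
    (r k : ℕ) (h : S (ModuleCat.of R (Ext N (I.cocomplex.cycles r) k))) :
    S (ModuleCat.of R (Ext N X (k + r))) := by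
  induction r generalizing k with
  | zero =>
    exact Ext.prop_of_iso N (Limits.IsLimit.conePointUniqueUpToIso
      (I.cocomplex.cyclesIsKernel 0 1 (by simp)) I.isLimitKernelFork) h
  | succ r ih =>
    have : Injective (I.cocomplex.cyclesCycles r).X₂ :=
      inferInstanceAs (Injective (I.cocomplex.X r))
    rw [show k + (r + 1) = k + 1 + r by lia]
    exact ih (k + 1)
      (Ext.prop_X₁_succ N (cyclesCycles_shortExact (I.cocomplex_exactAt_succ r)) h)

/-- Let `K` be a complex of injectives mapping to an injective resolution of `X` by
monomorphisms through which all maps from `N` factor. If the modules `Ext^{t-j}(N, H^j(K))`,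
`j ≤ t`, belong to a Serre class, then so does `Ext^t(N, X)`. -/
lemma Ext.prop_of_homology {X : ModuleCat.{u} R} (I : InjectiveResolution X)
    (K : CochainComplex (ModuleCat.{u} R) ℕ) [∀ n, Injective (K.X n)] (φ : K ⟶ I.cocomplex)
    [∀ n, Mono (φ.f n)] (hφ : ∀ (n : ℕ) (f : N ⟶ I.cocomplex.X n), ∃ g, g ≫ φ.f n = f) (t : ℕ)
    (h : ∀ i j, i + j = t → S (ModuleCat.of R (Ext N (K.homology j) i))) :
    S (ModuleCat.of R (Ext N X t)) := by
  have hcycles (n : ℕ) (x : Ext N (I.cocomplex.cycles n) 0) :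
      ∃ y : Ext N (K.cycles n) 0, y.comp (Ext.mk₀ (cyclesMap φ n)) (add_zero 0) = x := by
    obtain ⟨f, rfl⟩ := Ext.addEquiv₀.symm.surjective x
    obtain ⟨g, hg⟩ := hφ n (f ≫ I.cocomplex.iCycles n)
    refine ⟨Ext.mk₀ (K.liftCycles g (n + 1) (by simp) ?_), ?_⟩
    -- The lift lands in cycles because `φ` is a monomorphism in degree `n + 1`.
    · rw [← cancel_mono (φ.f (n + 1)), Category.assoc, ← φ.comm, reassoc_of% hg]
      simp
    · rw [Ext.mk₀_comp_mk₀]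
      congr 1
      simp [← cancel_mono (I.cocomplex.iCycles n), hg]
  cases t with
  | zero =>
    refine Ext.prop_of_injectiveResolution I 0 0 ?_
    refine ObjectProperty.of_surjective (Ext.postcompOfLinear (Ext.mk₀ (cyclesMap φ 0)) R N
      (add_zero 0)) (hcycles 0) ?_
    exact Ext.prop_of_iso N K.isoHomologyπ₀.symm (h 0 0 rfl)
  | succ t =>
    rw [add_comm t 1]
    refine Ext.prop_of_injectiveResolution I t 1 ?_
    have hI := cyclesCycles_shortExact (I.cocomplex_exactAt_succ t)
    have : Injective (I.cocomplex.cyclesCycles t).X₂ :=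
      inferInstanceAs (Injective (I.cocomplex.X t))
    refine ObjectProperty.of_surjective_of_ker_le_range
      (Ext.postcompOfLinear hI.extClass R N (zero_add 1) ∘ₗ
        Ext.postcompOfLinear (Ext.mk₀ (cyclesMap φ (t + 1))) R N (add_zero 0)) ?_
      (Ext.postcompOfLinear (Ext.mk₀ (K.homologyπ (t + 1))) R N (add_zero 0))
      (Ext.postcompOfLinear (Ext.mk₀ (cyclesMap φ t)) R N (add_zero 1)) ?_
      (h 0 (t + 1) (by lia))
      (Ext.prop_cycles_succ N K t 0 fun i j hij _ => h i j hij)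
    · intro x
      obtain ⟨y, rfl⟩ := Ext.exists_comp_extClass N hI x
      obtain ⟨z, rfl⟩ := hcycles (t + 1) y
      exact ⟨z, rfl⟩
    -- A map that dies in homology comes from boundaries of `K`; naturality of the extension class
    -- then places its image in the range of `Ext^1(N, Z^t(K))`.
    · intro x hx
      obtain ⟨y, rfl⟩ : ∃ y : Ext N (Limits.image (K.toCycles t (t + 1))) 0,
          y.comp (Ext.mk₀ (Limits.image.ι _)) (add_zero 0) = x :=
        Ext.covariant_sequence_exact₂ N (K.boundariesHomology_shortExact t) x hx
      let δK : Ext (Limits.image (K.toCycles t (t + 1))) (K.cycles t) 1 :=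
        (K.cyclesBoundaries_shortExact t).extClass
      let δI : Ext (I.cocomplex.cycles (t + 1)) (I.cocomplex.cycles t) 1 := hI.extClass
      have nat : δK.comp (Ext.mk₀ (cyclesMap φ t)) (add_zero 1) =
          (Ext.mk₀ (Limits.image.ι _ ≫ cyclesMap φ (t + 1))).comp δI (zero_add 1) :=
        ShortComplex.ShortExact.extClass_naturality (K.cyclesBoundaries_shortExact t) hI
          (cyclesBoundariesToCyclesCycles φ t)
      refine ⟨y.comp δK (zero_add 1), ?_⟩
      change (y.comp δK _).comp (Ext.mk₀ (cyclesMap φ t)) (add_zero 1) =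
        ((y.comp (Ext.mk₀ _) _).comp (Ext.mk₀ (cyclesMap φ (t + 1))) (add_zero 0)).comp δI
          (zero_add 1)
      rw [Ext.comp_assoc_of_third_deg_zero, nat, ← Ext.mk₀_comp_mk₀,
        Ext.comp_assoc_of_third_deg_zero y, ← Ext.comp_assoc_of_second_deg_zero]

end CategoryTheory.Abelian

section

variable {R : Type u} [CommRing R]

/-- The inclusion of the torsion functor into the identity functor. -/
@[simps]
noncomputable def torsionFunctorι (𝔞 : Ideal R) : torsionFunctor 𝔞 ⟶ 𝟭 (ModuleCat.{u} R) where
  app M := ModuleCat.ofHom (Ideal.primaryComponent M 𝔞).subtype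

instance (𝔞 : Ideal R) (M : ModuleCat.{u} R) : Mono ((torsionFunctorι 𝔞).app M) :=
  (ModuleCat.mono_iff_injective _).mpr Subtype.val_injective

instance [IsNoetherianRing R] (𝔞 : Ideal R) (E : ModuleCat.{u} R) [hE : Injective E] :
    Injective ((torsionFunctor 𝔞).obj E) := by
  have : Injective (ModuleCat.of R E) := hE
  exact Module.injective_object_of_injective_module _ _ (inj := (Ideal.primaryComponent_baer 𝔞
    (.of_injective (Module.injective_module_of_injective_object R E))).injective)

lemma IsIdealTorsion.exists_comp_torsionFunctorι {𝔞 : Ideal R} {N : ModuleCat.{u} R}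
    (hN : IsIdealTorsion 𝔞 N) {M : ModuleCat.{u} R} (f : N ⟶ M) : ∃ g, g ≫ (torsionFunctorι 𝔞).app M = f := by
  have hmem (x : N) : f.hom x ∈ Ideal.primaryComponent M 𝔞 :=
    Ideal.primaryComponent_map_mem 𝔞 f.hom ⟨x, by
      rw [show Ideal.primaryComponent N 𝔞 = ⊤ from hN]; trivial⟩
  exact ⟨ModuleCat.ofHom (f.hom.codRestrict _ hmem), rfl⟩

end

theorem theorem2p1 {R : Type u} [CommRing R] [IsNoetherianRing R] (𝔞 : Ideal R)
    (S : ObjectProperty (ModuleCat.{u} R)) [S.IsSerreClass]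
    (N : ModuleCat.{u} R) [Module.Finite R N] (hN : IsIdealTorsion 𝔞 N)
    (X : ModuleCat.{u} R) (t : ℕ)
    (h : ∀ r : ℕ, r ≤ t →
      S (ModuleCat.of R (Abelian.Ext N (localCohomologyModule 𝔞 r X) (t - r)))) :
    S (ModuleCat.of R (Abelian.Ext N X t)) := by
  let I := injectiveResolution X
  let K := ((torsionFunctor 𝔞).mapHomologicalComplex _).obj I.cocomplex
  let φ : K ⟶ I.cocomplex :=
    { f := fun n => (torsionFunctorι 𝔞).app (I.cocomplex.X n)
      comm' := fun i j _ => ((torsionFunctorι 𝔞).naturality (I.cocomplex.d i j)).symm }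
  have (n : ℕ) : Injective (K.X n) :=
    inferInstanceAs (Injective ((torsionFunctor 𝔞).obj (I.cocomplex.X n)))
  have (n : ℕ) : Mono (φ.f n) :=
    inferInstanceAs (Mono ((torsionFunctorι 𝔞).app (I.cocomplex.X n)))
  refine Abelian.Ext.prop_of_homology N I K φ (fun n f => hN.exists_comp_torsionFunctorι f) t ?_
  intro i j hij
  have hj := Abelian.Ext.prop_of_iso N (I.isoRightDerivedObj (torsionFunctor 𝔞) j)
    (h j (by lia))
  rwa [show t - j = i by lia] at hj
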